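/- Let $k$ be an algebraically closed field of characteristic $p>0$ and let $G$ be a smooth connected affine algebraic group over $k$ (for instance a simply connected semisimple one). A parabolic subgroup of $G$ is a smooth connected closed subgroup $P$ such that $G/P$ is complete, and a Borel subgroup is a solvable parabolic subgroup. Let $B\subseteq P$ be a Borel subgroup and a parabolic subgroup of $G$, and let $\pi\colon G/B\to G/P$ be the canonical projection. Let $X\subseteq G/P$ be a Schubert variety, that is, the closure of a $B$-orbit in $G/P$ with its reduced scheme structure, and let $\tilde X=\pi^{-1}(X)=G/B\times_{G/P}X$ be its scheme-theoretic preimage in $G/B$. Then the canonical map $\mathcal O_X\to\pi_*\mathcal O_{\tilde X}$, associated with the projection $\tilde X\to X$, is an isomorphism of sheaves. Moreover, if $\tilde X$ is globally $F$-regular, then so is $X$. Here a variety $Z$ over $k$ is called globally $F$-regular if for every invertible sheaf $\mathcal L$ on $Z$ and every nonzero $a\in\Gamma(Z,\mathcal L)$ there is an integer $e\ge 0$ such that the composite $\mathcal O_Z\to F^e_*\mathcal O_Z\xrightarrow{F^e_*a}F^e_*\mathcal L$ has an $\mathcal O_Z$-linear splitting, where $F$ is the absolute Frobenius morphism of $Z$.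 -/

import Mathlib

open CategoryTheory Limits AlgebraicGeometry MonoidalCategory CartesianMonoidalCategory MonObj

universe u

noncomputable section

namespace Schubert

/-! ### Quotients, parabolic and Borel subgroups

Group schemes over `k` are group objects in `Over (Spec (.of k))`; a closed subgroup of `G` is given
by a homomorphism `inc : H ⟶ G` which is a closed immersion. -/

section Groups

variable {k : Type u} [Field k]

/-- `ρ : G ⟶ Q` is the quotient `G ⟶ G/H` of `G` by the right translations of the subgroup
`inc : H ⟶ G`: the morphism `ρ` is an fppf covering whose kernel pair is
`G × H ⇉ G`, `(g, h) ↦ g` and `(g, h) ↦ gh`. Equivalently, `Q` represents the fppf quotient sheaf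
`G/H`; in particular `(Q, ρ)` is unique up to a unique isomorphism. -/
structure IsQuotient {G H Q : Over (Spec (.of k))} [GrpObj G] (inc : H ⟶ G) (ρ : G ⟶ Q) : Prop where
  flat : Flat ρ.left
  surjective : Surjective ρ.left
  locallyOfFinitePresentation : LocallyOfFinitePresentation ρ.left
  isPullback : IsPullback (fst G H) (G ◁ inc ≫ μ) ρ ρ

/-- `inc : P ⟶ G` is a parabolic subgroup: `P` is a smooth connected closed subgroup of `G` such that
`G/P` is complete, i.e. proper over `k`. -/
structure IsParabolic {G P : Over (Spec (.of k))} [GrpObj G] [GrpObj P] (inc : P ⟶ G) : Prop where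
  isMonHom : IsMonHom inc
  isClosedImmersion : IsClosedImmersion inc.left
  smooth : Smooth P.hom
  connected : ConnectedSpace P.left
  proper : ∃ (Q : Over (Spec (.of k))) (ρ : G ⟶ Q), IsQuotient inc ρ ∧ IsProper Q.hom

/-- `inc : B ⟶ G` is a Borel subgroup: a (smooth connected) parabolic subgroup which is solvable.
As `B` is smooth over the algebraically closed field `k`, it is solvable exactly when the abstract
group `B(k)` is, the points `B(k)` being the morphisms `Spec k ⟶ B` over `k`. -/
structure IsBorel {G B : Over (Spec (.of k))} [GrpObj G] [GrpObj B] (inc : B ⟶ G) : Prop extends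
    IsParabolic inc where
  solvable : letI : Group (𝟙_ (Over (Spec (.of k))) ⟶ B) := Hom.group
    Group.IsSolvable (𝟙_ (Over (Spec (.of k))) ⟶ B)

/-- For a quotient map `ρ : G ⟶ Q = G/P` and a point `g ∈ G(k)`, the orbit map
`B ⟶ G/P`, `b ↦ b g P`. -/
def orbitMap {G B Q : Over (Spec (.of k))} [GrpObj G] (inc : B ⟶ G) (ρ : G ⟶ Q)
    (g : 𝟙_ (Over (Spec (.of k))) ⟶ G) : B ⟶ Q :=
  lift inc (toUnit B ≫ g) ≫ μ ≫ ρ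

/-- `i : X ⟶ Q = G/P` is a Schubert variety: the closure of a `B`-orbit in `G/P`, with its reduced
closed subscheme structure. -/
structure IsSchubertVariety {G B Q : Over (Spec (.of k))} [GrpObj G] (inc : B ⟶ G) (ρ : G ⟶ Q)
    {X : Scheme.{u}} (i : X ⟶ Q.left) : Prop where
  isReduced : IsReduced X
  isClosedImmersion : IsClosedImmersion i
  range_eq : ∃ g : 𝟙_ (Over (Spec (.of k))) ⟶ G,
    Set.range i = closure (Set.range (orbitMap inc ρ g).left)

end Groups

/-! ### Global `F`-regularity -/

section FRegular

/-- An `𝒪_X`-module is an invertible sheaf if it is locally isomorphic to the structure sheaf. -/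
def IsInvertible {X : Scheme.{u}} (L : X.Modules) : Prop :=
  ∀ x : X, ∃ U : X.Opens, x ∈ U ∧
    Nonempty (L.restrict U.ι ≅ (SheafOfModules.unit (U : Scheme.{u}).ringCatSheaf :
      (U : Scheme.{u}).Modules))

/-- For a scheme `X` of characteristic `p`, an `𝒪_X`-linear map `Fᵉ_* L ⟶ 𝒪_X`, where `F` is the
Frobenius morphism of `X`. Since `F` is the identity on the underlying space and the `p`-th power
map on functions, `Fᵉ_* L` is the abelian sheaf `L` on which a function `r` acts as
multiplication by `r ^ (p ^ e)`. -/
structure FrobeniusPushforwardHom (p e : ℕ) {X : Scheme.{u}} (L : X.Modules) where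
  app (U : X.Opens) : Γ(L, U) →+ Γ(X, U)
  map_app {U V : X.Opens} (h : U ≤ V) (m : Γ(L, V)) :
    app U (L.presheaf.map (homOfLE h).op m) = X.presheaf.map (homOfLE h).op (app V m)
  map_smul (U : X.Opens) (r : Γ(X, U)) (m : Γ(L, U)) : app U (r ^ (p ^ e) • m) = r * app U m

/-- A variety `X` of characteristic `p` is globally `F`-regular if for every invertible sheaf `L`
and every nonzero `a ∈ Γ(X, L)` there is `e ≥ 0` such that the composite
`𝒪_X ⟶ Fᵉ_* 𝒪_X ⟶ Fᵉ_* L` of the Frobenius map and of multiplication by `a` has an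
`𝒪_X`-linear splitting. The composite is the `𝒪_X`-linear map sending `1` to `a`, so a splitting
is an `𝒪_X`-linear map `φ : Fᵉ_* L ⟶ 𝒪_X` with `φ a = 1`. -/
def IsGloballyFRegular (p : ℕ) (X : Scheme.{u}) : Prop :=
  ∀ L : X.Modules, IsInvertible L → ∀ a : Γ(L, ⊤), a ≠ 0 →
    ∃ (e : ℕ) (φ : FrobeniusPushforwardHom p e L), φ.app ⊤ a = 1

end FRegular

end Schubert

end

/-! Let `π : G/B ⟶ G/P` be the projection and `q : X̃ ⟶ X` its base change along `X ⟶ G/P`.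

The isomorphism `𝒪_X = q_* 𝒪` may be checked after the faithfully flat affine base change
`G ×_{G/P} X ⟶ X` (`isIso_app_of_isPullback_of_surjective`), because forming `q_* 𝒪` commutes with
flat base change. Over `G` the fibration `π` becomes trivial with fibre `P/B`
(`exists_iso_tensor`): the schemes `G/B ×_{G/P} G` and `G × P/B` are both fppf quotients of `G × P`,
by `(g, h) ↦ (g h B, g)` and `(g, h) ↦ (g, h B)`, and the two maps have the same kernel pair. So the
base change of `q` is also a base change of `P/B ⟶ Spec k`, which is flat base change once more, and
it remains to see that `Γ(P/B, 𝒪) = k` (`isIso_appTop_fibre`). Here `P/B` is the fibre of `π` over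
the base point; it is closed in the proper scheme `G/B`, hence its functions are integral over `k`,
and they embed into the functions on the smooth connected affine scheme `P`, a reduced ring without
nontrivial idempotents.

Global `F`-regularity then passes from `X̃` to `X` (`IsGloballyFRegular.of_isIso_app`): for a
nonzero section `a` of an invertible sheaf `L` on `X`, the section `q^* a` of `q^* L` is nonzero,
and the direct image of a splitting for `q^* a` restricts along `L ⟶ q_* q^* L` to a splitting
for `a`. -/

noncomputable section

namespace Schubert

/-! ### Morphisms `f` with `𝒪 = f_* 𝒪` -/

section DirectImage

variable {X Y S T : Scheme.{u}} {f : T ⟶ S} {g : Y ⟶ X} {iX : X ⟶ S} {iY : Y ⟶ T}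

/-- That `𝒪_S ⟶ q_* 𝒪_X` is an isomorphism can be tested on affine opens. -/
theorem isIso_app_of_forall_isAffineOpen (q : X ⟶ S)
    (h : ∀ U : S.Opens, IsAffineOpen U → IsIso (q.app U)) (U : S.Opens) : IsIso (q.app U) := by
  let F : TopCat.Sheaf CommRingCat S := ⟨S.presheaf, S.IsSheaf⟩
  let F' : TopCat.Sheaf CommRingCat S :=
    (TopCat.Sheaf.pushforward CommRingCat q.base).obj ⟨X.presheaf, X.IsSheaf⟩
  let φ : F ⟶ F' := ⟨q.c⟩
  have : IsIso φ := TopCat.Sheaf.isIso_iff_isIso_basis (B := fun V : S.affineOpens ↦ (V : S.Opens))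
    (by simpa using S.isBasis_affineOpens) (fun V ↦ h V V.2)
  have : IsIso φ.hom := inferInstanceAs (IsIso ((TopCat.Sheaf.forget CommRingCat S).map φ))
  exact inferInstanceAs (IsIso (φ.hom.app (.op U)))

/-- Flat base change for global sections: over affine opens, the functions on the base change of a
quasi-compact quasi-separated morphism are the tensor product. -/
theorem isPushout_sections (H : IsPullback g iY iX f) [Flat f] [QuasiCompact iX]
    [QuasiSeparated iX] {U : S.Opens} (hU : IsAffineOpen U) {W : T.Opens} (hW : IsAffineOpen W)
    (hWU : W ≤ f ⁻¹ᵁ U) :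
    IsPushout (iX.app U) (f.appLE U W hWU)
      (g.appLE (iX ⁻¹ᵁ U) (iY ⁻¹ᵁ W)
        (by grw [← Scheme.Hom.comp_preimage, H.w, Scheme.Hom.comp_preimage, hWU]))
      (iY.app W) := by
  have := (isIso_pushoutSection_iff H hWU le_rfl (UY := iY ⁻¹ᵁ W) (by
    grw [← Scheme.Hom.comp_preimage, H.w, Scheme.Hom.comp_preimage, right_eq_inf, hWU])).mp
    (isIso_pushoutSection_of_isQuasiSeparated_of_flat_right H hWU le_rfl _ hU hW
      (iX.isCompact_preimage hU.isCompact) (iX.isQuasiSeparated_preimage hU.isQuasiSeparated))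
  simpa [Scheme.Hom.appLE] using this

/-- The property `𝒪_S = iX_* 𝒪_X` is preserved by flat base change. -/
theorem isIso_app_of_isPullback (H : IsPullback g iY iX f) [Flat f] [QuasiCompact iX]
    [QuasiSeparated iX] {U : S.Opens} (hU : IsAffineOpen U) [IsIso (iX.app U)] {W : T.Opens}
    (hW : IsAffineOpen W) (hWU : W ≤ f ⁻¹ᵁ U) : IsIso (iY.app W) :=
  (isPushout_sections H hU hW hWU).isIso_inr_of_isIso

/-- The property `𝒪_S = iX_* 𝒪_X` descends along a faithfully flat affine morphism `f`. -/
theorem isIso_app_of_isPullback_of_surjective (H : IsPullback g iY iX f) [Flat f] [Surjective f]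
    [IsAffineHom f] [QuasiCompact iX] [QuasiSeparated iX]
    (h : ∀ W : T.Opens, IsAffineOpen W → IsIso (iY.app W)) (U : S.Opens) :
    IsIso (iX.app U) := by
  refine isIso_app_of_forall_isAffineOpen _ (fun U hU ↦ ?_) U
  have hW : IsAffineOpen (f ⁻¹ᵁ U) := hU.preimage f
  have hP := isPushout_sections H hU hW le_rfl
  have := h _ hW
  have : IsAffine U := hU
  have : IsAffine (f ⁻¹ᵁ U) := hW
  have hff : (f.app U).hom.FaithfullyFlat := by
    have : Surjective (f ∣_ U) := IsZariskiLocalAtTarget.restrict (P := @Surjective) ‹_› U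
    have h1 : (f ∣_ U).appTop.hom.FaithfullyFlat :=
      (Flat.flat_and_surjective_iff_faithfullyFlat_of_isAffine _).mp ⟨inferInstance, inferInstance⟩
    rw [morphismRestrict_appTop] at h1
    have h2 : (f.app (U.ι ''ᵁ ⊤)).hom.FaithfullyFlat :=
      (RingHom.FaithfullyFlat.respectsIso.cancel_right_isIso (f.app (U.ι ''ᵁ ⊤)) (T.presheaf.map
        (eqToHom (image_morphismRestrict_preimage f U ⊤)).op)).mp h1
    rwa [U.ι_image_top] at h2
  rw [ConcreteCategory.isIso_iff_bijective]
  have hff' : (f.appLE U (f ⁻¹ᵁ U) le_rfl).hom.FaithfullyFlat := by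
    rwa [← Scheme.Hom.app_eq_appLE]
  algebraize [(iX.app U).hom, (f.appLE U (f ⁻¹ᵁ U) le_rfl).hom, (iY.app (f ⁻¹ᵁ U)).hom,
    (g.appLE (iX ⁻¹ᵁ U) (iY ⁻¹ᵁ f ⁻¹ᵁ U) (by rw [← Scheme.Hom.comp_preimage, ← H.w,
      Scheme.Hom.comp_preimage])).hom,
    (iY.app (f ⁻¹ᵁ U)).hom.comp (f.appLE U (f ⁻¹ᵁ U) le_rfl).hom]
  have : IsScalarTower Γ(S, U) Γ(X, iX ⁻¹ᵁ U) Γ(Y, iY ⁻¹ᵁ f ⁻¹ᵁ U) := .of_algebraMap_eq'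
    congr(($(hP.w)).hom).symm
  have := (CommRingCat.isPushout_iff_isPushout
    (R := Γ(S, U)) (R' := Γ(X, iX ⁻¹ᵁ U)) (S := Γ(T, f ⁻¹ᵁ U)) (S' := Γ(Y, iY ⁻¹ᵁ f ⁻¹ᵁ U))).mp hP
  exact RingHom.FaithfullyFlat.codescendsAlong_bijective
    (R := Γ(S, U)) (S := Γ(X, iX ⁻¹ᵁ U)) (R' := Γ(T, f ⁻¹ᵁ U)) (S' := Γ(Y, iY ⁻¹ᵁ f ⁻¹ᵁ U))
    hff' (ConcreteCategory.bijective_of_isIso (iY.app (f ⁻¹ᵁ U)))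

end DirectImage

/-! ### Global sections -/

/-- A smooth algebra `S` over a field `k` is reduced. Smooth base change preserves integral closures
and `k` is integrally closed in `k[X]`, hence `S` is integrally closed in `S[X]`; but `n X` is
nilpotent, in particular integral, when `n` is nilpotent. -/
theorem isReduced_of_smooth_of_field (k : Type*) {S : Type*} [Field k] [CommRing S] [Algebra k S]
    [Algebra.Smooth k S] : _root_.IsReduced S := by
  open TensorProduct Polynomial in
  refine ⟨fun n ⟨m, hn⟩ ↦ ?_⟩
  let t : S ⊗[k] k[X] := n ⊗ₜ X
  have ht : IsIntegral S t :=
    ⟨X ^ m, monic_X_pow m, by simp [t, Algebra.TensorProduct.tmul_pow, hn]⟩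
  obtain ⟨y, hy⟩ := TensorProduct.toIntegralClosure_bijective_of_smooth.2
    (⟨t, ht⟩ : integralClosure S (S ⊗[k] k[X]))
  -- the coefficient of `X`, which vanishes on `S ⊗ (integral closure of k in k[X])`
  let φ : S ⊗[k] k[X] →ₗ[k] S := (TensorProduct.rid k S).toLinearMap ∘ₗ (lcoeff k 1).lTensor S
  have hφ (z : S ⊗[k] integralClosure k k[X]) :
      φ (TensorProduct.toIntegralClosure k S k[X] z).1 = 0 := by
    induction z with
    | zero => simp
    | add a b ha hb => simp [ha, hb]
    | tmul a b =>
      -- a polynomial that is integral over `k` is constant: compare degrees in `q(b) = 0`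
      have hb : (b : k[X]).coeff 1 = 0 := by
        obtain ⟨q, hq, hqb⟩ := b.2
        have hdeg := congrArg natDegree ((comp_eq_aeval (p := q) (q := (b : k[X]))).trans hqb)
        rw [natDegree_comp, natDegree_zero, mul_eq_zero] at hdeg
        refine coeff_eq_zero_of_natDegree_lt ?_
        rcases hdeg with h | h
        · rw [hq.natDegree_eq_zero] at h
          simp [h] at hqb
        · simp [h]
      simp [φ, TensorProduct.toIntegralClosure, hb]
  have := hφ y
  rw [hy] at this
  simpa [t, φ] using this

theorem appTop_injective_of_flat_of_surjective {X Y : Scheme.{u}} (f : X ⟶ Y) [Flat f]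
    [Surjective f] : Function.Injective f.appTop := by
  rw [injective_iff_map_eq_zero]
  intro s hs
  refine TopCat.Presheaf.section_ext Y.sheaf ⊤ _ _ fun y hy ↦ ?_
  obtain ⟨x, rfl⟩ := f.surjective y
  have hinj : Function.Injective (f.stalkMap x) := by
    algebraize [(f.stalkMap x).hom]
    have : Module.FaithfullyFlat (Y.presheaf.stalk (f x)) (X.presheaf.stalk x) :=
      @Module.FaithfullyFlat.of_flat_of_isLocalHom _ _ _ _ _ _ _
        (Flat.stalkMap f x) (f.toLRSHom.prop x)
    exact ‹RingHom.FaithfullyFlat _›.injective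
  apply hinj
  change f.stalkMap x (Y.presheaf.germ ⊤ (f x) hy s) = f.stalkMap x (Y.presheaf.germ ⊤ (f x) hy 0)
  rw [Scheme.Hom.germ_stalkMap_apply, map_zero, map_zero]
  exact (congrArg _ hs).trans (map_zero _)

/-- An integral algebra over an algebraically closed field that embeds into a reduced ring with
connected spectrum is the field itself. -/
theorem bijective_of_isIntegral {k A R : Type*} [Field k] [IsAlgClosed k] [CommRing A] [CommRing R]
    [_root_.IsReduced R] [Nontrivial R] (hR : ∀ e : R, IsIdempotentElem e → e = 0 ∨ e = 1)
    (f : k →+* A) (hf : f.IsIntegral) (g : A →+* R) (hg : Function.Injective g) :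
    Function.Bijective f := by
  have : Nontrivial A := g.domain_nontrivial
  have : _root_.IsReduced A := isReduced_of_injective g hg
  have hA (e : A) (he : IsIdempotentElem e) : e = 0 ∨ e = 1 := by
    refine (hR (g e) (he.map g)).imp (fun h ↦ hg ?_) (fun h ↦ hg ?_) <;> simpa using h
  refine ⟨f.injective, fun a ↦ ?_⟩
  have key (s : Multiset k) (hs : (s.map fun c ↦ a - f c).prod = 0) : ∃ c, f c = a := by
    induction s using Multiset.induction with
    | empty => simp at hs
    | cons c s ih =>
      rw [Multiset.map_cons, Multiset.prod_cons] at hs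
      by_cases hc : c ∈ s
      · -- a repeated root can be dropped since `A` is reduced
        refine ih (pow_eq_zero_iff (n := 2) (by simp) |>.mp ?_)
        obtain ⟨w, hw⟩ := Multiset.dvd_prod (Multiset.mem_map_of_mem (fun c ↦ a - f c) hc)
        rw [sq]
        nth_rw 1 [hw]
        rw [mul_right_comm, hs, zero_mul]
      · have hcop : IsCoprime (a - f c) (s.map fun c ↦ a - f c).prod := by
          clear ih hs
          induction s using Multiset.induction with
          | empty => simpa using isCoprime_one_right
          | cons d s ih =>
            rw [Multiset.mem_cons, not_or] at hc
            rw [Multiset.map_cons, Multiset.prod_cons]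
            refine IsCoprime.mul_right ⟨-f (c - d)⁻¹, f (c - d)⁻¹, ?_⟩ (ih hc.2)
            rw [neg_mul, neg_add_eq_sub, ← mul_sub, sub_sub_sub_cancel_left, ← map_sub, ← map_mul,
              inv_mul_cancel₀ (sub_ne_zero.mpr hc.1), map_one]
        obtain ⟨x, y, hxy⟩ := hcop
        -- `x * (a - f c)` and `y * ∏ (a - f d)` are orthogonal idempotents with sum `1`
        set r := (s.map fun c ↦ a - f c).prod
        have he : IsIdempotentElem (x * (a - f c)) := by
          rw [IsIdempotentElem]
          linear_combination x * (a - f c) * hxy - x * y * hs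
        obtain h | h := hA _ he
        · refine ⟨c, (sub_eq_zero.mp ?_).symm⟩
          linear_combination (-(a - f c)) * hxy + y * hs + (a - f c) * h
        · refine ih ?_
          linear_combination x * hs - r * h
  obtain ⟨q, hq, hqa⟩ := hf a
  refine key q.roots ?_
  rw [← Polynomial.eval_map] at hqa
  have := (IsAlgClosed.splits q).eq_prod_roots_of_monic hq
  rw [this] at hqa
  simpa [Polynomial.map_multiset_prod, Polynomial.eval_multiset_prod, Function.comp_def] using hqa

theorem eq_zero_or_eq_one_of_isIdempotentElem (X : Scheme.{u}) [ConnectedSpace X] (e : Γ(X, ⊤))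
    (he : IsIdempotentElem e) : e = 0 ∨ e = 1 := by
  have key (e : Γ(X, ⊤)) (he : IsIdempotentElem e) (h : X.basicOpen e = ⊤) : e = 1 := by
    refine TopCat.Presheaf.section_ext X.sheaf ⊤ _ _ fun x hx ↦ ?_
    have hu : IsUnit (X.presheaf.germ ⊤ x hx e) := by
      rw [← Scheme.mem_basicOpen, h]
      trivial
    refine (IsIdempotentElem.iff_eq_one_of_isUnit hu).mp (he.map _) |>.trans (map_one _).symm
  have hinf : X.basicOpen e ⊓ X.basicOpen (1 - e) = ⊥ := by
    rw [← Scheme.basicOpen_mul, he.mul_one_sub_self, Scheme.basicOpen_zero]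
  have hsup : X.basicOpen e ⊔ X.basicOpen (1 - e) = ⊤ := by
    have := X.basicOpen_add_le e (1 - e)
    rwa [add_sub_cancel, Scheme.basicOpen_one, top_le_iff] at this
  have hc : IsClopen (X.basicOpen e : Set X) := by
    refine ⟨?_, (X.basicOpen e).isOpen⟩
    have hcompl : IsCompl (X.basicOpen e : Set X) (X.basicOpen (1 - e)) := by
      refine ⟨Set.disjoint_iff_inter_eq_empty.mpr ?_, codisjoint_iff.mpr ?_⟩
      · exact congrArg (fun U : X.Opens ↦ (U : Set X)) hinf
      · exact congrArg (fun U : X.Opens ↦ (U : Set X)) hsup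
    rw [← hcompl.symm.compl_eq]
    exact (X.basicOpen (1 - e)).isOpen.isClosed_compl
  rcases isClopen_iff.mp hc with h | h
  · left
    have h' : X.basicOpen e = ⊥ := TopologicalSpace.Opens.ext h
    have := key _ he.one_sub (by rwa [h', bot_sup_eq] at hsup)
    simpa using this
  · exact .inr (key e he (TopologicalSpace.Opens.ext h))

/-! ### Effective epimorphisms with the same kernel pair -/

/-- Two morphisms out of `M` over `S` that are effective epimorphisms of schemes and have the same
kernel pair have isomorphic targets. -/
theorem exists_iso_of_effectiveEpi {S : Scheme.{u}} {M W W' : Over S} (a : M ⟶ W) (b : M ⟶ W')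
    [EffectiveEpi a.left] [EffectiveEpi b.left]
    (h : ∀ (T : Over S) (x y : T ⟶ M), x ≫ a = y ≫ a ↔ x ≫ b = y ≫ b) :
    ∃ e : W ≅ W', a ≫ e.hom = b := by
  -- the kernel pairs over `S` agree with those of the underlying schemes, since morphisms
  -- identified by `a` or `b` have the same composite to `S`
  have key {T : Scheme.{u}} (x y : T ⟶ M.left) : x ≫ a.left = y ≫ a.left ↔
      x ≫ b.left = y ≫ b.left := by
    by_cases hxy : x ≫ M.hom = y ≫ M.hom
    · let x' : Over.mk (x ≫ M.hom) ⟶ M := Over.homMk x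
      let y' : Over.mk (x ≫ M.hom) ⟶ M := Over.homMk y hxy.symm
      have := h _ x' y'
      simpa [Over.OverMorphism.ext_iff, x', y'] using this
    · constructor
      · intro h; refine absurd ?_ hxy; rw [← Over.w a, reassoc_of% h]
      · intro h; refine absurd ?_ hxy; rw [← Over.w b, reassoc_of% h]
  let u := EffectiveEpi.desc a.left b.left fun x y hxy ↦ (key x y).mp hxy
  let v := EffectiveEpi.desc b.left a.left fun x y hxy ↦ (key x y).mpr hxy
  have hu : a.left ≫ u = b.left := EffectiveEpi.fac ..
  have hv : b.left ≫ v = a.left := EffectiveEpi.fac ..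
  have : Epi a.left := inferInstance
  have : Epi b.left := inferInstance
  let e : W.left ≅ W'.left := ⟨u, v, by simp [← cancel_epi a.left, reassoc_of% hu, hv],
    by simp [← cancel_epi b.left, reassoc_of% hv, hu]⟩
  refine ⟨Over.isoMk e ?_, ?_⟩
  · simp [e, ← cancel_epi a.left, reassoc_of% hu]
  · ext1; simpa [e] using hu

/-! ### Quotients of group schemes -/

section Quotients

variable {k : Type u} [Field k]

/-- Flat surjective morphisms locally of finite presentation. -/
abbrev fppf : MorphismProperty Scheme.{u} :=
  @Flat ⊓ @Surjective ⊓ @LocallyOfFinitePresentation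

theorem effectiveEpi_of_fppf {X Y : Scheme.{u}} {f : X ⟶ Y} (hf : fppf f) : EffectiveEpi f := by
  obtain ⟨⟨_, _⟩, _⟩ := hf
  infer_instance

theorem fppf_left_of_isPullback {S : Scheme.{u}} {A B C D : Over S} {a : A ⟶ B} {b : A ⟶ C}
    {c : B ⟶ D} {d : C ⟶ D} (H : IsPullback a b c d) (hc : fppf c.left) : fppf b.left :=
  have H' := H.map (Over.forget S)
  ⟨⟨MorphismProperty.of_isPullback (P := @Flat) H' hc.1.1,
    MorphismProperty.of_isPullback (P := @Surjective) H' hc.1.2⟩,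
    MorphismProperty.of_isPullback (P := @LocallyOfFinitePresentation) H' hc.2⟩

variable {G H Q : Over (Spec (.of k))} [GrpObj G] {inc : H ⟶ G} {ρ : G ⟶ Q}

theorem IsQuotient.fppf (hρ : IsQuotient inc ρ) : fppf ρ.left :=
  ⟨⟨hρ.flat, hρ.surjective⟩, hρ.locallyOfFinitePresentation⟩

/-- Two points of `G` have the same image in `G/H` if and only if they differ by a point of `H`. -/
theorem IsQuotient.comp_eq_iff (hρ : IsQuotient inc ρ) {T : Over (Spec (.of k))} (g g' : T ⟶ G) :
    g ≫ ρ = g' ≫ ρ ↔ ∃ h : T ⟶ H, g * (h ≫ inc) = g' := by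
  constructor
  · intro h
    obtain ⟨t, rfl, rfl⟩ := hρ.isPullback.exists_lift g g' h
    have ht : lift (t ≫ fst G H) ((t ≫ snd G H) ≫ inc) = t ≫ G ◁ inc := by ext1 <;> simp
    exact ⟨t ≫ snd G H, by rw [Hom.mul_def, ht, Category.assoc]⟩
  · rintro ⟨h, rfl⟩
    have := lift g h ≫= hρ.isPullback.w
    simpa [Hom.mul_def] using this

theorem IsQuotient.mul_comp_eq_iff (hρ : IsQuotient inc ρ) {T : Over (Spec (.of k))}
    (g h h' : T ⟶ G) : (g * h) ≫ ρ = (g * h') ≫ ρ ↔ h ≫ ρ = h' ≫ ρ := by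
  simp only [hρ.comp_eq_iff]
  refine exists_congr fun b ↦ ?_
  rw [_root_.mul_assoc, mul_right_inj]

/-- The quotient `G/H` is unique up to isomorphism. -/
theorem IsQuotient.exists_iso (hρ : IsQuotient inc ρ) {Q' : Over (Spec (.of k))} {ρ' : G ⟶ Q'}
    (hρ' : IsQuotient inc ρ') : ∃ e : Q ≅ Q', ρ ≫ e.hom = ρ' := by
  have := effectiveEpi_of_fppf hρ.fppf
  have := effectiveEpi_of_fppf hρ'.fppf
  refine exists_iso_of_effectiveEpi ρ ρ' fun T x y ↦ ?_
  rw [hρ.comp_eq_iff, hρ'.comp_eq_iff]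

/-- If some quotient `G/H` is proper, every one is. -/
theorem IsQuotient.isProper [GrpObj H] (hρ : IsQuotient inc ρ) (hH : IsParabolic inc) :
    IsProper Q.hom := by
  obtain ⟨Q', ρ', hρ', _⟩ := hH.proper
  obtain ⟨e, -⟩ := hρ.exists_iso hρ'
  have : IsIso e.hom.left := inferInstanceAs (IsIso ((Over.forget _).map e.hom))
  rw [← Over.w e.hom]
  infer_instance

/-- The fibre of `ρ : G ⟶ G/H` over the base point is `H`. -/
theorem IsQuotient.isPullback_one (hρ : IsQuotient inc ρ) [GrpObj H] [IsMonHom inc] [Mono inc] :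
    IsPullback inc (toUnit H) ρ (η[G] ≫ ρ) := by
  have h1 (T : Over (Spec (.of k))) (u : T ⟶ 𝟙_ (Over (Spec (.of k)))) :
      u ≫ η[G] = (1 : T ⟶ G) := by rw [toUnit_unique u (toUnit T), Hom.one_def]
  have key (s : PullbackCone ρ (η[G] ≫ ρ)) : ∃ h : s.pt ⟶ H, h ≫ inc = s.fst := by
    obtain ⟨h, hh⟩ := (hρ.comp_eq_iff 1 s.fst).mp (by
      rw [s.condition, ← Category.assoc, h1])
    exact ⟨h, by simpa using hh⟩
  choose l hl using key
  refine ⟨⟨?_⟩, ⟨PullbackCone.IsLimit.mk _ l hl (fun s ↦ toUnit_unique _ _) fun s m hm _ ↦ ?_⟩⟩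
  · rw [← Category.assoc, h1, ← (hρ.comp_eq_iff (1 : H ⟶ G) inc).mpr ⟨𝟙 H, by simp⟩]
  · rw [← cancel_mono inc, hm, hl]

end Quotients

/-! ### The fibration `G/B ⟶ G/P` -/

section Fibration

variable {k : Type u} [Field k] {G B P GB GP : Over (Spec (.of k))} [GrpObj G]
  {ιB : B ⟶ G} {ιP : P ⟶ G} {ρB : G ⟶ GB} {ρP : G ⟶ GP} {π : GB ⟶ GP}

instance mono_of_unit (X : Over (Spec (.of k))) (f : 𝟙_ (Over (Spec (.of k))) ⟶ X) : Mono f :=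
  ⟨fun _ _ _ ↦ toUnit_unique _ _⟩

/-- The base change of `π : G/B ⟶ G/P` along `G ⟶ G/P` is the trivial fibration with fibre
`Z = P/B`, the fibre of `π` over the base point: both are quotients of `G × P` by `B`. -/
theorem exists_iso_tensor (hρB : IsQuotient ιB ρB) (hρP : IsQuotient ιP ρP) (hπ : ρB ≫ π = ρP)
    {W Z : Over (Spec (.of k))} {wB : W ⟶ GB} {wG : W ⟶ G} (hW : IsPullback wB wG π ρP)
    {z : Z ⟶ GB} (hZ : IsPullback z (toUnit Z) π (η[G] ≫ ρP))
    {q : P ⟶ Z} (hq : IsPullback ιP q ρB z) :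
    ∃ e : W ≅ G ⊗ Z, e.hom ≫ fst G Z = wG := by
  subst hπ
  let a : G ⊗ P ⟶ W := hW.lift ((G ◁ ιP ≫ μ) ≫ ρB) (fst G P)
    (by rw [Category.assoc, hρP.isPullback.w])
  have ha1 : a ≫ wB = (G ◁ ιP ≫ μ) ≫ ρB := hW.lift_fst _ _ _
  have ha2 : a ≫ wG = fst G P := hW.lift_snd _ _ _
  -- both `a` and `G ◁ q` are base changes of `ρB`, hence fppf
  have ha : IsPullback (G ◁ ιP ≫ μ) a ρB wB :=
    .of_bot (by simpa only [ha2] using hρP.isPullback.flip) ha1.symm hW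
  have hb : IsPullback (snd G P) (G ◁ q) q (snd G Z) := by
    refine ⟨⟨by simp⟩, ⟨PullbackCone.IsLimit.mk _ (fun s ↦ lift (s.snd ≫ fst G Z) s.fst)
      (by simp) (fun s ↦ ?_) fun s m h₁ h₂ ↦ ?_⟩⟩
    · ext1
      · simp
      · simp [s.condition]
    · ext1
      · simp [← h₂]
      · simp [← h₁]
  have := effectiveEpi_of_fppf (fppf_left_of_isPullback ha hρB.fppf)
  have := effectiveEpi_of_fppf (fppf_left_of_isPullback hb
    (fppf_left_of_isPullback hq hρB.fppf))
  have : Mono z :=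
    MorphismProperty.of_isPullback (P := .monomorphisms _) hZ.flip (inferInstance : Mono _)
  obtain ⟨e, he⟩ := exists_iso_of_effectiveEpi a (G ◁ q) fun T x y ↦ by
    -- `(g, h)` and `(g, h')` have the same image under `a` if and only if `g h B = g h' B`, and
    -- under `G ◁ q` if and only if `h B = h' B`
    have hμ (x : T ⟶ G ⊗ P) : x ≫ G ◁ ιP ≫ μ = (x ≫ fst G P) * (x ≫ snd G P ≫ ιP) := by
      have ht : lift (x ≫ fst G P) (x ≫ snd G P ≫ ιP) = x ≫ G ◁ ιP := by ext1 <;> simp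
      rw [Hom.mul_def, ht, Category.assoc]
    have h1 : x ≫ a = y ≫ a ↔ x ≫ fst G P = y ≫ fst G P ∧
        (x ≫ G ◁ ιP ≫ μ) ≫ ρB = (y ≫ G ◁ ιP ≫ μ) ≫ ρB := by
      constructor
      · intro h
        exact ⟨by simpa [ha2] using h =≫ wG, by simpa [ha1] using h =≫ wB⟩
      · rintro ⟨h, h'⟩
        exact hW.hom_ext (by simpa [ha1] using h') (by simpa [ha2] using h)
    have h2 : x ≫ G ◁ q = y ≫ G ◁ q ↔ x ≫ fst G P = y ≫ fst G P ∧
        (x ≫ snd G P ≫ ιP) ≫ ρB = (y ≫ snd G P ≫ ιP) ≫ ρB := by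
      constructor
      · intro h
        refine ⟨by simpa using h =≫ fst _ _, ?_⟩
        simpa [hq.w] using h =≫ (snd _ _ ≫ z)
      · rintro ⟨h, h'⟩
        refine CartesianMonoidalCategory.hom_ext _ _ (by simpa using h) ?_
        rw [← cancel_mono z]
        simpa [hq.w] using h'
    rw [h1, h2, hμ, hμ]
    refine and_congr_right fun h ↦ ?_
    rw [h, hρB.mul_comp_eq_iff]
  refine ⟨e, ?_⟩
  have : Epi a := Over.epi_of_epi_left a
  rw [← cancel_epi a, reassoc_of% he, ha2]
  simp

/-- The only functions on `Z = P/B` are the constants: `Γ(Z)` is integral over `k` since `Z` is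
universally closed, and it embeds into `Γ(P)`, which is reduced and has only the trivial
idempotents. -/
theorem isIso_appTop_fibre [IsAlgClosed k] [ConnectedSpace P.left] [IsAffine P.left] [Smooth P.hom]
    (Z : Over (Spec (.of k))) [UniversallyClosed Z.hom] (q : P ⟶ Z) (hq : fppf q.left) :
    IsIso Z.hom.appTop := by
  obtain ⟨⟨_, _⟩, _⟩ := hq
  let e := (Scheme.ΓSpecIso (.of k)).inv
  let i := e ≫ Z.hom.appTop
  have hi : i.hom.IsIntegral :=
    RingHom.isIntegral_respectsIso.2 (e := (Scheme.ΓSpecIso (.of k)).symm.commRingCatIsoToRingEquiv)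
      _ (isIntegral_appTop_of_universallyClosed Z.hom)
  have : Nontrivial Γ(P.left, ⊤) := by
    have : Nonempty (⊤ : P.left.Opens) := ⟨⟨Classical.arbitrary P.left, trivial⟩⟩
    infer_instance
  have hred : _root_.IsReduced Γ(P.left, ⊤) := by
    have hs : (e ≫ P.hom.appTop).hom.Smooth := by
      rw [CommRingCat.hom_comp]
      exact RingHom.Smooth.comp (RingHom.Smooth.of_bijective
        (ConcreteCategory.bijective_of_isIso e))
        (HasRingHomProperty.appTop (P := @Smooth) P.hom ‹_›)
    algebraize [(e ≫ P.hom.appTop).hom]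
    exact isReduced_of_smooth_of_field k
  have hbij := bijective_of_isIntegral (eq_zero_or_eq_one_of_isIdempotentElem P.left) i.hom hi
    q.left.appTop.hom (appTop_injective_of_flat_of_surjective q.left)
  have : IsIso i := (ConcreteCategory.isIso_iff_bijective _).mpr hbij
  exact IsIso.of_isIso_comp_left e _

/-- For `π : G/B ⟶ G/P` and a morphism `i : X ⟶ G/P`, the base change `q` of `π` along `i`
satisfies `𝒪_X = q_* 𝒪`. -/
theorem isIso_app_pullback_snd [IsAlgClosed k] [IsAffine G.left] [GrpObj B] [GrpObj P]
    (hB : IsParabolic ιB) (hP : IsParabolic ιP)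
    (hρB : IsQuotient ιB ρB) (hρP : IsQuotient ιP ρP) (hπ : ρB ≫ π = ρP)
    {X : Scheme.{u}} (i : X ⟶ GP.left) (U : X.Opens) :
    IsIso ((pullback.snd π.left i).app U) := by
  have := hP.isMonHom
  have := hP.isClosedImmersion
  have := hP.smooth
  have := hP.connected
  have := hρB.isProper hB
  have := hρP.isProper hP
  have : IsAffine P.left := isAffine_of_isAffineHom ιP.left
  have : Mono ιP := Over.mono_of_mono_left ιP
  have : IsProper π.left := by
    have : IsProper (π.left ≫ GP.hom) := by rwa [Over.w]
    exact .of_comp π.left GP.hom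
  -- the fibre of `π` over the base point, and the morphism from `P`
  let Z := pullback π (η[G] ≫ ρP)
  let z : Z ⟶ GB := pullback.fst _ _
  have hZ : IsPullback z (toUnit Z) π (η[G] ≫ ρP) := by
    simpa only [toUnit_unique (pullback.snd π (η[G] ≫ ρP)) (toUnit Z)] using
      IsPullback.of_hasPullback π (η[G] ≫ ρP)
  have hone := hρP.isPullback_one
  let q : P ⟶ Z := hZ.lift (ιP ≫ ρB) (toUnit P) (by rw [Category.assoc, hπ, hone.w])
  have hqz : q ≫ z = ιP ≫ ρB := hZ.lift_fst _ _ _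
  have hq : IsPullback ιP q ρB z :=
    .of_bot (by rwa [hπ, toUnit_unique (q ≫ toUnit Z) (toUnit P)]) hqz.symm hZ
  have hZproper : IsProper Z.hom := by
    have : IsClosedImmersion (η[G] ≫ ρP).left :=
      isClosedImmersion_of_comp_eq_id (Y := Spec (.of k)) GP.hom (η[G] ≫ ρP).left
        (Over.w (η[G] ≫ ρP))
    have : IsClosedImmersion z.left :=
      MorphismProperty.of_isPullback (hZ.map (Over.forget _)).flip this
    rw [← Over.w z]
    infer_instance
  have hZiso : IsIso Z.hom.appTop :=
    isIso_appTop_fibre (P := P) Z q (fppf_left_of_isPullback hq hρB.fppf)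
  -- `ρP`, and hence its base change `G ×_{G/P} X ⟶ X`, is affine and faithfully flat
  have : IsAffineHom ρP.left := by
    have : IsAffineHom (ρP.left ≫ GP.hom) := by rw [Over.w]; infer_instance
    exact .of_comp _ GP.hom
  obtain ⟨⟨_, _⟩, _⟩ := hρP.fppf
  obtain ⟨e, he⟩ := exists_iso_tensor hρB hρP hπ (IsPullback.of_hasPullback π ρP) hZ hq
  have H1 : IsPullback (pullback.fst π ρP).left (pullback.snd π ρP).left π.left ρP.left :=
    (IsPullback.of_hasPullback π ρP).map (Over.forget _)
  have H2 : IsPullback (e.hom ≫ snd G Z).left (pullback.snd π ρP).left Z.hom G.hom := by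
    have h1 : IsPullback (snd G Z) (fst G Z) (toUnit Z) (toUnit G) :=
      ⟨⟨toUnit_unique _ _⟩, ⟨PullbackCone.IsLimit.mk _ (fun s ↦ lift s.snd s.fst)
        (by simp) (by simp) fun s m h₁ h₂ ↦ by ext1 <;> simp [← h₁, ← h₂]⟩⟩
    have h2 : IsPullback (e.hom ≫ snd G Z) (pullback.snd π ρP) (toUnit Z) (toUnit G) :=
      h1.of_iso e.symm (.refl _) (.refl _) (.refl _) (by simp) (by simp [← he]) (by simp) (by simp)
    exact h2.map (Over.forget _)
  -- `W = G/B ×_{G/P} G` is the base change of `π` along `G ⟶ G/P` by `H1`, and of `Z ⟶ Spec k` by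
  -- `H2`; both squares are pulled back to `G ×_{G/P} X`
  have H3 := IsPullback.of_hasPullback (pullback.snd π ρP).left (pullback.fst ρP.left i)
  have H4 : IsPullback (pullback.fst (pullback.snd π ρP).left (pullback.fst ρP.left i) ≫
    (e.hom ≫ snd G Z).left) (pullback.snd _ _) Z.hom (pullback.fst ρP.left i ≫ G.hom) :=
    H3.paste_horiz H2
  have H5 : IsPullback (pullback.fst (pullback.snd π ρP).left (pullback.fst ρP.left i) ≫
    (pullback.fst π ρP).left) (pullback.snd _ _) π.left (pullback.fst ρP.left i ≫ ρP.left) :=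
    H3.paste_horiz H1
  have H6 := IsPullback.of_hasPullback π.left i
  have H7 := H5
  rw [pullback.condition] at H7
  let g := H6.lift (pullback.fst (pullback.snd π ρP).left (pullback.fst ρP.left i) ≫
    (pullback.fst π ρP).left) (pullback.snd _ _ ≫ pullback.snd ρP.left i)
    (by rw [H7.w, Category.assoc])
  have H8 : IsPullback g (pullback.snd (pullback.snd π ρP).left (pullback.fst ρP.left i))
      (pullback.snd π.left i) (pullback.snd ρP.left i) := by
    refine .of_right (t := H6) ?_ (H6.lift_snd _ _ _)
    rwa [H6.lift_fst]
  have : IsAffineHom (pullback.snd ρP.left i) :=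
    MorphismProperty.of_isPullback (P := @IsAffineHom) (.of_hasPullback ρP.left i) ‹_›
  have : Flat (pullback.snd ρP.left i) :=
    MorphismProperty.of_isPullback (P := @Flat) (.of_hasPullback ρP.left i) ‹_›
  have : Surjective (pullback.snd ρP.left i) :=
    MorphismProperty.of_isPullback (P := @Surjective) (.of_hasPullback ρP.left i) ‹_›
  refine isIso_app_of_isPullback_of_surjective H8 (fun T hT ↦ ?_) U
  have : Flat (pullback.fst ρP.left i ≫ G.hom) :=
    inferInstanceAs (Flat (Y := Spec (.of k)) _)
  have : IsIso (Z.hom.app ⊤) := hZiso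
  exact isIso_app_of_isPullback H4 (isAffineOpen_top _) hT le_top

end Fibration

/-! ### Global `F`-regularity and direct images -/

section FRegular

variable {X Y : Scheme.{u}}

/-- The structure sheaf as a module over itself. -/
abbrev unitModule (X : Scheme.{u}) : X.Modules := SheafOfModules.unit X.ringCatSheaf

/-- The canonical morphism `𝒪_X ⟶ q_* 𝒪_Y`. -/
def unitToPushforward (q : Y ⟶ X) :
    unitModule X ⟶ (Scheme.Modules.pushforward q).obj (unitModule Y) :=
  SheafOfModules.unitToPushforwardObjUnit q.toRingCatSheafHom

/-- The pullback of the structure sheaf is the structure sheaf. -/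
def pullbackUnitIso (q : Y ⟶ X) : (Scheme.Modules.pullback q).obj (unitModule X) ≅ unitModule Y :=
  -- taking preimages of opens preserves the terminal object `⊤`
  have : (TopologicalSpace.Opens.map q.base).Final := by
    have h (T : TopologicalSpace.Opens X) (hT : T = ⊤) :
        IsTerminal ((TopologicalSpace.Opens.map q.base).obj T) := by
      subst hT
      exact .ofUniqueHom (fun U ↦ homOfLE fun _ _ ↦ trivial) fun _ _ ↦ rfl
    have := preservesTerminal_of_iso (TopologicalSpace.Opens.map q.base)
      ((h _ (top_le_iff.mp (leOfHom (terminal.from ⊤)))).uniqueUpToIso terminalIsTerminal)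
    infer_instance
  have : (SheafOfModules.pushforward.{u} q.toRingCatSheafHom).IsRightAdjoint :=
    (Scheme.Modules.pullbackPushforwardAdjunction q).isRightAdjoint
  @asIso _ _ _ _ (SheafOfModules.pullbackObjUnitToUnit q.toRingCatSheafHom)
    (SheafOfModules.instIsIsoPullbackObjUnitToUnitOfFinal _)

theorem IsInvertible.pullback {L : X.Modules} (hL : IsInvertible L) (q : Y ⟶ X) :
    IsInvertible ((Scheme.Modules.pullback q).obj L) := by
  intro y
  obtain ⟨U, hU, ⟨α⟩⟩ := hL (q y)
  refine ⟨q ⁻¹ᵁ U, hU, ⟨?_⟩⟩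
  have h : (q ⁻¹ᵁ U).ι ≫ q = (q ∣_ U) ≫ U.ι := (morphismRestrict_ι q U).symm
  exact (Scheme.Modules.restrictFunctorIsoPullback (q ⁻¹ᵁ U).ι).app _ ≪≫
    (Scheme.Modules.pullbackComp (q ⁻¹ᵁ U).ι q).app L ≪≫
    (Scheme.Modules.pullbackCongr h).app L ≪≫
    ((Scheme.Modules.pullbackComp (q ∣_ U) U.ι).app L).symm ≪≫
    (Scheme.Modules.pullback (q ∣_ U)).mapIso
      (((Scheme.Modules.restrictFunctorIsoPullback U.ι).app L).symm ≪≫ α) ≪≫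
    pullbackUnitIso (q ∣_ U)

/-- If `𝒪_X ⟶ q_* 𝒪_Y` is injective, so is `Γ(X, L) ⟶ Γ(Y, q^* L)` for an invertible sheaf `L`. -/
theorem unit_app_injective (q : Y ⟶ X) (hq : ∀ U, Function.Injective (q.app U))
    {L : X.Modules} (hL : IsInvertible L) :
    Function.Injective
      (((Scheme.Modules.pullbackPushforwardAdjunction q).unit.app L).app ⊤) := by
  rw [injective_iff_map_eq_zero]
  intro a ha
  -- `a` vanishes locally
  refine TopCat.Presheaf.section_ext ⟨L.presheaf, L.isSheaf⟩ ⊤ _ _ fun x hx ↦ ?_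
  obtain ⟨U, hU, ⟨α'⟩⟩ := hL x
  let α : L.restrict U.ι ≅ unitModule U := α'
  have hj : (q ∣_ U) ≫ U.ι = (q ⁻¹ᵁ U).ι ≫ q := morphismRestrict_ι q U
  -- the restriction `L ⟶ L|_U ≅ 𝒪_U ⟶ q_* 𝒪_{q⁻¹ U}`, as a morphism to a direct image under `q`
  let β : L ⟶ (Scheme.Modules.pushforward U.ι).obj
      ((Scheme.Modules.pushforward (q ∣_ U)).obj (unitModule (q ⁻¹ᵁ U))) :=
    (Scheme.Modules.restrictAdjunction U.ι).unit.app L ≫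
      (Scheme.Modules.pushforward U.ι).map (α.hom ≫ unitToPushforward (q ∣_ U))
  let κ : (Scheme.Modules.pushforward U.ι).obj
      ((Scheme.Modules.pushforward (q ∣_ U)).obj (unitModule (q ⁻¹ᵁ U))) ≅
      (Scheme.Modules.pushforward q).obj
        ((Scheme.Modules.pushforward (q ⁻¹ᵁ U).ι).obj (unitModule (q ⁻¹ᵁ U))) :=
    (Scheme.Modules.pushforwardComp (q ∣_ U) U.ι ≪≫ Scheme.Modules.pushforwardCongr hj ≪≫
      (Scheme.Modules.pushforwardComp (q ⁻¹ᵁ U).ι q).symm).app _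
  -- by adjunction, it factors through the unit, so it kills `a`
  have hfac : (Scheme.Modules.pullbackPushforwardAdjunction q).unit.app L ≫
      (Scheme.Modules.pushforward q).map
        (((Scheme.Modules.pullbackPushforwardAdjunction q).homEquiv _ _).symm (β ≫ κ.hom)) =
      β ≫ κ.hom :=
    ((Scheme.Modules.pullbackPushforwardAdjunction q).homEquiv_unit ..).symm.trans
      (Equiv.apply_symm_apply ..)
  have hβκ : (β ≫ κ.hom).app ⊤ a = 0 := by
    rw [← hfac, Scheme.Modules.Hom.comp_app, CategoryTheory.comp_apply, ha, map_zero]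
  have hβ : β.app ⊤ a = 0 := by
    rw [Scheme.Modules.Hom.comp_app, CategoryTheory.comp_apply] at hβκ
    refine (ConcreteCategory.bijective_of_isIso (κ.hom.app ⊤)).1 ?_
    rw [hβκ, map_zero]
  have hβa : β.app ⊤ a = (q ∣_ U).app ⊤ (α.hom.app ⊤
      (L.presheaf.map (homOfLE (U.ι.image_preimage_le ⊤)).op a)) := rfl
  rw [hβa] at hβ
  have hα : α.hom.app ⊤ (L.presheaf.map (homOfLE (U.ι.image_preimage_le ⊤)).op a) = 0 := by
    have hinj : Function.Injective ((q ∣_ U).app ⊤) := by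
      rw [morphismRestrict_app]
      exact (ConcreteCategory.bijective_of_isIso (Y.presheaf.map
        (eqToHom (image_morphismRestrict_preimage q U ⊤)).op)).1.comp (hq _)
    exact hinj (hβ.trans (map_zero _).symm)
  have hres : L.presheaf.map (homOfLE (U.ι.image_preimage_le ⊤)).op a = 0 := by
    have : IsIso (α.hom.app ⊤) := Scheme.Modules.Hom.isIso_iff_isIso_app.mp inferInstance ⊤
    refine (ConcreteCategory.bijective_of_isIso (α.hom.app ⊤)).1 ?_
    exact hα.trans (map_zero _).symm
  have hxU : x ∈ U.ι ''ᵁ U.ι ⁻¹ᵁ ⊤ := by simpa using hU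
  have h1 := TopCat.Presheaf.germ_res_apply L.presheaf (homOfLE (U.ι.image_preimage_le ⊤)) x hxU
  refine (h1 a).symm.trans (.trans ?_ (h1 0))
  exact (congrArg _ hres).trans (congrArg _ (map_zero _).symm)

/-- Global `F`-regularity descends along a morphism `q : Y ⟶ X` with `𝒪_X = q_* 𝒪_Y`: a splitting
`Fᵉ_* q^* L ⟶ 𝒪_Y` for the pullback of a section of `L` is pushed forward and composed with
`L ⟶ q_* q^* L`. -/
theorem IsGloballyFRegular.of_isIso_app {p : ℕ} (q : Y ⟶ X) (hq : ∀ U, IsIso (q.app U))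
    (hY : IsGloballyFRegular p Y) : IsGloballyFRegular p X := by
  intro L hL a ha
  let N := (Scheme.Modules.pullback q).obj L
  let θ : L ⟶ (Scheme.Modules.pushforward q).obj N :=
    (Scheme.Modules.pullbackPushforwardAdjunction q).unit.app L
  let t (U : X.Opens) : Γ(L, U) →+ Γ(N, q ⁻¹ᵁ U) := (θ.app U).hom
  have t_smul (U : X.Opens) (r : Γ(X, U)) (m : Γ(L, U)) : t U (r • m) = q.app U r • t U m :=
    θ.app_smul r m
  have t_map {U V : X.Opens} (h : U ≤ V) (m : Γ(L, V)) : t U (L.presheaf.map (homOfLE h).op m) =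
      N.presheaf.map (homOfLE (q.preimage_mono h)).op (t V m) :=
    ConcreteCategory.congr_hom (θ.mapPresheaf.naturality (homOfLE h).op) m
  have hq1 (U : X.Opens) : Function.Injective (q.app U) :=
    (ConcreteCategory.bijective_of_isIso (q.app U)).1
  have hinv (U : X.Opens) (b : Γ(Y, q ⁻¹ᵁ U)) : q.app U (inv (q.app U) b) = b := by
    rw [← CategoryTheory.comp_apply, IsIso.inv_hom_id]
    rfl
  have hinj := unit_app_injective q hq1 hL
  obtain ⟨e, φ, hφ⟩ := hY N (hL.pullback q) (t ⊤ a)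
    fun h ↦ ha (hinj (h.trans (map_zero _).symm))
  refine ⟨e, ⟨fun U ↦ (inv (q.app U)).hom.toAddMonoidHom.comp ((φ.app (q ⁻¹ᵁ U)).comp (t U)),
    fun {U V} h m ↦ hq1 U ?_, fun U r m ↦ hq1 U ?_⟩, hq1 ⊤ ?_⟩
  · change q.app U (inv (q.app U) (φ.app (q ⁻¹ᵁ U) (t U (L.presheaf.map (homOfLE h).op m)))) =
      q.app U (X.presheaf.map (homOfLE h).op (inv (q.app V) (φ.app (q ⁻¹ᵁ V) (t V m))))
    have h1 := ConcreteCategory.congr_hom (q.naturality (homOfLE h).op)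
      (inv (q.app V) (φ.app (q ⁻¹ᵁ V) (t V m)))
    rw [CategoryTheory.comp_apply, CategoryTheory.comp_apply, hinv] at h1
    rw [hinv, t_map, φ.map_app, h1]
    rfl
  · change q.app U (inv (q.app U) (φ.app (q ⁻¹ᵁ U) (t U (r ^ p ^ e • m)))) =
      q.app U (r * inv (q.app U) (φ.app (q ⁻¹ᵁ U) (t U m)))
    rw [map_mul, hinv, hinv, t_smul, map_pow, φ.map_smul]
  · change q.app ⊤ (inv (q.app ⊤) (φ.app ⊤ (t ⊤ a))) = _
    rw [map_one]
    exact (hinv ⊤ _).trans hφ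

end FRegular

end Schubert

end

theorem lemma2p5 {k : Type u} [Field k] [IsAlgClosed k] (p : ℕ) [Fact p.Prime] [CharP k p]
    -- a smooth connected affine algebraic group `G` over `k`
    (G : Over (Spec (.of k))) [GrpObj G] [IsAffine G.left] [Smooth G.hom] [ConnectedSpace G.left]
    -- a Borel subgroup `B` and a parabolic subgroup `P` containing it
    (B P : Over (Spec (.of k))) [GrpObj B] [GrpObj P] (ιB : B ⟶ G) (ιP : P ⟶ G)
    (hB : Schubert.IsBorel ιB) (hP : Schubert.IsParabolic ιP) (hBP : ∃ j : B ⟶ P, j ≫ ιP = ιB)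
    -- the quotients `G/B` and `G/P` and the canonical projection `π : G/B ⟶ G/P`
    (GB GP : Over (Spec (.of k))) (ρB : G ⟶ GB) (ρP : G ⟶ GP)
    (hρB : Schubert.IsQuotient ιB ρB) (hρP : Schubert.IsQuotient ιP ρP)
    (π : GB ⟶ GP) (hπ : ρB ≫ π = ρP)
    -- a Schubert variety `X` in `G/P`; its preimage in `G/B` is `pullback π.left i`
    (X : Scheme.{u}) (i : X ⟶ GP.left) (hX : Schubert.IsSchubertVariety ιB ρP i) :
    (∀ U : X.Opens, IsIso ((pullback.snd π.left i).app U)) ∧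
      (Schubert.IsGloballyFRegular p (pullback π.left i) → Schubert.IsGloballyFRegular p X) := by
  have hπ' : ∀ U : X.Opens, IsIso ((pullback.snd π.left i).app U) :=
    Schubert.isIso_app_pullback_snd hB.toIsParabolic hP hρB hρP hπ i
  exact ⟨hπ', .of_isIso_app _ hπ'⟩
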